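/- Let $\mathfrak X=(X,\{R_i\}_{i=0}^d)$ be a commutative association scheme of class $d$ on a finite set $X$: the relations $R_i$ are nonempty, and their adjacency matrices $A_0,\dots,A_d$ satisfy $A_0=I$, $\sum_i A_i=J$ (the all-ones matrix), each $A_i^{\top}$ is some $A_{i'}$, and $A_iA_j=A_jA_i=\sum_k p_{ij}^kA_k$ with non-negative integers $p_{ij}^k$. Let $E_0=|X|^{-1}J,E_1,\dots,E_d$ be the primitive idempotents of the Bose–Mesner algebra $\langle A_0,\dots,A_d\rangle_{\mathbb C}$, and define $P,Q$ by $A_i=\sum_jP_{j,i}E_j$ and $E_i=|X|^{-1}\sum_jQ_{j,i}A_j$. Let $k_i=P_{0,i}$ be the valencies (the row sums of the $A_i$), $m_i=Q_{0,i}$ the multiplicities, and $c_{i,j}=P_{i,j}/k_j$ the cosines. Let $N\ge 1$ and $\mathcal I=\{\beta\in\mathbb Z_{\ge 0}^{d+1}:\beta_0+\dots+\beta_d=N\}$. For $\beta\in\mathcal I$ let $A_\beta=\sum A_{i_1}\otimes\cdots\otimes A_{i_N}$, the sum being over all words $(i_1,\dots,i_N)\in\{0,\dots,d\}^N$ in which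 each letter $k$ occurs exactly $\beta_k$ times; these are the adjacency matrices of the $N$-th symmetric tensor product $\mathrm{Sym}(\mathfrak X,N)$, a commutative association scheme on $X^N$. Denote by $k_\beta$ the valency (row sum) of $A_\beta$, and by $e_0,\dots,e_d$ the unit vectors of $\mathbb Z^{d+1}$. Let $w_1,\dots,w_d\in\mathbb C$ be such that $M=\sum_{i=1}^d w_iA_{(N-1)e_0+e_i}$ is Hermitian. Then for every $t\in\mathbb R$ $$e^{-\mathrm i tM}=\sum_{\beta\in\mathcal I}f_\beta(t)A_\beta,\qquad f_\beta(t)=\frac1{|X|^N}\,e^{-\mathrm i tN\sum_{i=1}^dw_ik_i}\prod_{k=0}^d p_k(t)^{\beta_k},$$ where $$p_k(t)=1+\sum_{\ell=1}^d\overline{c_{\ell,k}}\,m_\ell\,e^{\mathrm i t\sum_{i=1}^dw_ik_i(1-c_{\ell,i})}.$$ In particular, for $x_0\in X^N$ and $|Y_\beta\rangle=k_\beta^{-1/2}A_\beta|x_0\rangle$, the walk that starts at $|x_0\rangle$ does not occur at $|Y_\beta\rangle$ at time $t$, that is $\langle Y_\beta|e^{-\mathrm i tM}|x_0\rangle=0$,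 whenever $p_k(t)=0$ for some $k$ with $\beta_k\ne0$. -/

import Mathlib

open scoped Matrix

noncomputable section

/-- The adjacency matrix of a binary relation, with complex entries. -/
def relMatrix {X : Type*} (R : X → X → Prop) : Matrix X X ℂ :=
  open Classical in Matrix.of fun x y => if R x y then 1 else 0

/-- A commutative association scheme on the finite set `X`, whose relations are indexed by `ι`,
the index `o` being that of the identity relation.  Class `d` means `ι = Fin (d + 1)`, `o = 0`. -/
structure CommAssocScheme (X ι : Type*) [Fintype X] [DecidableEq X] [Fintype ι] (o : ι) where
  rel : ι → X → X → Prop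
  rel_nonempty : ∀ i, ∃ x y, rel i x y
  rel_base : relMatrix (rel o) = 1
  sum_rel : ∑ i, relMatrix (rel i) = Matrix.of fun _ _ => 1
  transpose_rel : ∀ i, ∃ i', (relMatrix (rel i))ᵀ = relMatrix (rel i')
  mul_rel : ∀ i j, ∃ p : ι → ℕ,
    relMatrix (rel i) * relMatrix (rel j) = ∑ k, (p k : ℂ) • relMatrix (rel k)
  mul_comm_rel : ∀ i j,
    relMatrix (rel i) * relMatrix (rel j) = relMatrix (rel j) * relMatrix (rel i)

/-- A primitive idempotent of a ring: a nonzero idempotent `e` such that `0` and `e` are the only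
idempotents `f` with `e * f = f = f * e`. -/
def IsPrimitiveIdem {R : Type*} [Ring R] (e : R) : Prop :=
  e ≠ 0 ∧ IsIdempotentElem e ∧
    ∀ f : R, IsIdempotentElem f → e * f = f → f * e = f → f = 0 ∨ f = e

namespace CommAssocScheme

section General

variable {X ι : Type*} [Fintype X] [DecidableEq X] [Fintype ι] {o : ι}
  (S : CommAssocScheme X ι o)

/-- The adjacency matrices `A_i`. -/
def adj (i : ι) : Matrix X X ℂ := relMatrix (S.rel i)

theorem existsUnique_rel (x y : X) : ∃! i, S.rel i x y := by
  classical
  have h := congrFun (congrFun S.sum_rel x) y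
  rw [Matrix.sum_apply] at h
  simp only [relMatrix, Matrix.of_apply, Finset.sum_boole] at h
  have h1 : (Finset.univ.filter fun i => S.rel i x y).card = 1 := by exact_mod_cast h
  obtain ⟨i, hi⟩ := Finset.card_eq_one.1 h1
  have hm : ∀ j, S.rel j x y ↔ j = i := fun j => by
    have := Finset.ext_iff.1 hi j
    simpa using this
  exact ⟨i, (hm i).2 rfl, fun j hj => (hm j).1 hj⟩

/-- The index of the relation that contains `(x, y)`. -/
def cls (x y : X) : ι := (S.existsUnique_rel x y).choose

theorem rel_iff (i : ι) (x y : X) : S.rel i x y ↔ S.cls x y = i :=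
  ⟨fun h => ((S.existsUnique_rel x y).choose_spec.2 i h).symm,
    fun h => h ▸ (S.existsUnique_rel x y).choose_spec.1⟩

theorem adj_apply [DecidableEq ι] (i : ι) (x y : X) :
    S.adj i x y = if S.cls x y = i then 1 else 0 := by
  simp only [adj, relMatrix, Matrix.of_apply, S.rel_iff]

theorem adj_base : S.adj o = 1 := S.rel_base

theorem sum_smul_adj_apply (c : ι → ℂ) (x y : X) :
    (∑ i, c i • S.adj i) x y = c (S.cls x y) := by
  classical
  simp [Matrix.sum_apply, S.adj_apply]

theorem linearIndependent_adj : LinearIndependent ℂ S.adj := by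
  rw [Fintype.linearIndependent_iff]
  intro c hc i
  obtain ⟨x, y, h⟩ := S.rel_nonempty i
  have := S.sum_smul_adj_apply c x y
  rw [(S.rel_iff i x y).1 h, hc] at this
  simpa using this.symm

theorem adj_mem_span (i : ι) : S.adj i ∈ Submodule.span ℂ (Set.range S.adj) :=
  Submodule.subset_span ⟨i, rfl⟩

/-- The Bose–Mesner algebra: the linear span of the adjacency matrices. -/
def boseMesner : Subalgebra ℂ (Matrix X X ℂ) :=
  (Submodule.span ℂ (Set.range S.adj)).toSubalgebra (S.adj_base ▸ S.adj_mem_span o) (by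
    intro a b ha hb
    induction ha, hb using Submodule.span_induction₂ with
    | mem_mem a b ha hb =>
      obtain ⟨i, rfl⟩ := ha
      obtain ⟨j, rfl⟩ := hb
      obtain ⟨p, hp⟩ := S.mul_rel i j
      have : S.adj i * S.adj j = ∑ k, (p k : ℂ) • S.adj k := hp
      rw [this]
      exact Submodule.sum_mem _ fun k _ => Submodule.smul_mem _ _ (S.adj_mem_span k)
    | zero_left => simp
    | zero_right => simp
    | add_left => rw [add_mul]; exact Submodule.add_mem _ (by assumption) (by assumption)
    | add_right => rw [mul_add]; exact Submodule.add_mem _ (by assumption) (by assumption)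
    | smul_left => rw [smul_mul_assoc]; exact Submodule.smul_mem _ _ (by assumption)
    | smul_right => rw [mul_smul_comm]; exact Submodule.smul_mem _ _ (by assumption))

theorem mem_boseMesner {a : Matrix X X ℂ} :
    a ∈ S.boseMesner ↔ a ∈ Submodule.span ℂ (Set.range S.adj) := Iff.rfl

/-- The adjacency matrix as an element of the Bose–Mesner algebra. -/
def adjElt (i : ι) : S.boseMesner := ⟨S.adj i, S.adj_mem_span i⟩

/-- The basis of the Bose–Mesner algebra that consists of the adjacency matrices. -/
def adjBasis : Module.Basis ι ℂ S.boseMesner :=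
  Module.Basis.mk (v := S.adjElt)
    (LinearIndependent.of_comp S.boseMesner.val.toLinearMap S.linearIndependent_adj) (by
      rintro ⟨a, ha⟩ -
      obtain ⟨c, rfl⟩ := (Submodule.mem_span_range_iff_exists_fun ℂ).1 (S.mem_boseMesner.1 ha)
      refine (Submodule.mem_span_range_iff_exists_fun ℂ).2 ⟨c, ?_⟩
      ext1
      simp [adjElt])

/-- Some point of `X`. -/
def point : X := (S.rel_nonempty o).choose

/-- The valency `k_i`: the number of `y` with `(x, y) ∈ R_i`; see `card_rel_eq_valency` for the
independence of `x`. -/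
def valency (i : ι) : ℕ := Nat.card {y // S.rel i S.point y}

theorem cls_self (x : X) : S.cls x x = o := by
  classical
  have h := congrFun (congrFun S.adj_base x) x
  rw [S.adj_apply] at h
  by_contra hc
  simp [hc] at h

theorem card_rel_eq_valency (i : ι) (x : X) : Nat.card {y // S.rel i x y} = S.valency i := by
  classical
  obtain ⟨i', hi'⟩ := S.transpose_rel i
  obtain ⟨p, hp⟩ := S.mul_rel i i'
  have key : ∀ x, (Nat.card {y // S.rel i x y} : ℂ) = p o := by
    intro x
    have h := congrFun (congrFun hp x) x
    have h2 := S.sum_smul_adj_apply (fun k => (p k : ℂ)) x x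
    rw [S.cls_self] at h2
    rw [← hi', Matrix.mul_apply] at h
    simp only [adj] at h2
    rw [h2] at h
    rw [← h, Nat.card_eq_fintype_card, Fintype.card_subtype]
    simp only [relMatrix, Matrix.transpose_apply, Matrix.of_apply]
    rw [Finset.card_filter, Nat.cast_sum]
    exact Finset.sum_congr rfl fun y _ => by by_cases hy : S.rel i x y <;> simp [hy]
  have := (key x).trans (key S.point).symm
  exact_mod_cast this

/-- The primitive idempotents `E_i` of the Bose–Mesner algebra, in some order that begins
with `E_o = |X|⁻¹ J`: they form a basis of the algebra. -/
structure PrimitiveIdempotents where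
  E : Module.Basis ι ℂ S.boseMesner
  isPrimitive : ∀ i, IsPrimitiveIdem (E i)
  base : (E o : Matrix X X ℂ) = (Fintype.card X : ℂ)⁻¹ • Matrix.of fun _ _ => 1

theorem allOnes_mem : (Matrix.of fun _ _ => 1 : Matrix X X ℂ) ∈ S.boseMesner := by
  rw [← S.sum_rel]
  exact S.boseMesner.sum_mem fun i _ => S.adj_mem_span i

theorem adj_mul_allOnes (i : ι) :
    S.adj i * (Matrix.of fun _ _ => 1 : Matrix X X ℂ) =
      (S.valency i : ℂ) • (Matrix.of fun _ _ => 1 : Matrix X X ℂ) := by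
  classical
  ext x y
  rw [Matrix.mul_apply, ← S.card_rel_eq_valency i x, Nat.card_eq_fintype_card,
    Fintype.card_subtype]
  simp [adj, relMatrix, Finset.sum_boole]

theorem mul_comm_of_mem {a b : Matrix X X ℂ} (ha : a ∈ S.boseMesner) (hb : b ∈ S.boseMesner) :
    a * b = b * a := by
  rw [mem_boseMesner] at ha hb
  induction ha, hb using Submodule.span_induction₂ with
  | mem_mem a b ha hb =>
    obtain ⟨i, rfl⟩ := ha
    obtain ⟨j, rfl⟩ := hb
    exact S.mul_comm_rel i j
  | zero_left => simp
  | zero_right => simp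
  | add_left => rw [add_mul, mul_add]; congr
  | add_right => rw [add_mul, mul_add]; congr
  | smul_left => rw [smul_mul_assoc, mul_smul_comm]; congr
  | smul_right => rw [smul_mul_assoc, mul_smul_comm]; congr

theorem conjTranspose_mem {a : Matrix X X ℂ} (ha : a ∈ S.boseMesner) : aᴴ ∈ S.boseMesner := by
  rw [mem_boseMesner] at ha ⊢
  obtain ⟨c, rfl⟩ := (Submodule.mem_span_range_iff_exists_fun ℂ).1 ha
  rw [Matrix.conjTranspose_sum]
  refine Submodule.sum_mem _ fun i _ => ?_
  rw [Matrix.conjTranspose_smul]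
  refine Submodule.smul_mem _ _ ?_
  obtain ⟨i', hi'⟩ := S.transpose_rel i
  have : (S.adj i)ᴴ = S.adj i' := by
    change _ = relMatrix _
    rw [← hi']
    ext x y
    simp only [adj, relMatrix, Matrix.conjTranspose_apply, Matrix.transpose_apply, Matrix.of_apply]
    split_ifs <;> simp
  rw [this]
  exact S.adj_mem_span i'

open scoped ComplexOrder in
/-- The primitive idempotents of the Bose–Mesner algebra exist. -/
theorem nonempty_primitiveIdempotents : Nonempty S.PrimitiveIdempotents := by
  classical
  let B := S.boseMesner
  let _ : CommRing B :=
    { (inferInstance : Ring B) with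
      mul_comm := fun a b => Subtype.ext (S.mul_comm_of_mem a.2 b.2) }
  have : Module.Finite ℂ B := Module.Finite.of_basis S.adjBasis
  have : IsArtinianRing B := IsArtinianRing.of_finite ℂ B
  have : IsReduced B := by
    rw [isReduced_iff_pow_one_lt 2 one_lt_two]
    rintro ⟨a, ha⟩ h
    have h0 : a * a = 0 := by
      have := congrArg Subtype.val h
      rwa [pow_two] at this
    have hc : a * aᴴ = aᴴ * a := S.mul_comm_of_mem ha (S.conjTranspose_mem ha)
    refine Subtype.ext (Matrix.conjTranspose_mul_self_eq_zero.1
      (Matrix.conjTranspose_mul_self_eq_zero.1 ?_))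
    rw [Matrix.conjTranspose_mul, Matrix.conjTranspose_conjTranspose, mul_assoc, ← mul_assoc a, hc,
      mul_assoc, h0]
    simp
  have hbij : ∀ I : MaximalSpectrum B, Function.Bijective (algebraMap ℂ (B ⧸ I.asIdeal)) := by
    intro I
    have := I.isMaximal
    exact IsAlgClosed.algebraMap_bijective_of_isIntegral
  let φ : B ≃ₐ[ℂ] (MaximalSpectrum B → ℂ) :=
    ((IsArtinianRing.equivPi B).restrictScalars ℂ).trans
      (AlgEquiv.piCongrRight fun I => (AlgEquiv.ofBijective (Algebra.ofId ℂ _) (hbij I)).symm)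
  have : Fintype (MaximalSpectrum B) := Fintype.ofFinite _
  let b : Module.Basis (MaximalSpectrum B) ℂ B := (Pi.basisFun ℂ _).map φ.symm.toLinearEquiv
  have hb : ∀ I, φ (b I) = Pi.single I 1 := fun I => by simp [b]
  have hprim : ∀ I, IsPrimitiveIdem (b I) := by
    intro I
    refine ⟨b.ne_zero I, φ.injective ?_, fun f hf h1 _ => ?_⟩
    · rw [map_mul, hb, ← Pi.single_mul, one_mul]
    · have hf' : ∀ K, φ f K * φ f K = φ f K := fun K => by
        rw [← Pi.mul_apply, ← map_mul]
        exact congrFun (congrArg φ hf) K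
      have h1' : ∀ K, (Pi.single I 1 : MaximalSpectrum B → ℂ) K * φ f K = φ f K := fun K => by
        rw [← hb, ← Pi.mul_apply, ← map_mul, h1]
      have hz : ∀ K, K ≠ I → φ f K = 0 := fun K hK => by
        rw [← h1' K, Pi.single_eq_of_ne hK, zero_mul]
      have h01 : φ f I = 0 ∨ φ f I = 1 := IsIdempotentElem.iff_eq_zero_or_one.1 (hf' I)
      rcases h01 with h | h
      · left
        refine φ.injective (funext fun K => ?_)
        by_cases hK : K = I
        · rw [hK, h, map_zero]; rfl
        · rw [hz K hK, map_zero]; rfl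
      · right
        refine φ.injective (funext fun K => ?_)
        rw [hb]
        by_cases hK : K = I
        · rw [hK, h, Pi.single_eq_same]
        · rw [hz K hK, Pi.single_eq_of_ne hK]
  have : Nonempty X := ⟨S.point⟩
  have hcard : (Fintype.card X : ℂ) ≠ 0 := Nat.cast_ne_zero.2 Fintype.card_ne_zero
  let J : Matrix X X ℂ := Matrix.of fun _ _ => 1
  have hJ : ∀ a ∈ S.boseMesner, ∃ c : ℂ, a * J = c • J := by
    intro a ha
    obtain ⟨c, rfl⟩ := (Submodule.mem_span_range_iff_exists_fun ℂ).1 (S.mem_boseMesner.1 ha)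
    refine ⟨∑ i, c i * S.valency i, ?_⟩
    rw [Finset.sum_mul, Finset.sum_smul]
    refine Finset.sum_congr rfl fun i _ => ?_
    rw [smul_mul_assoc, S.adj_mul_allOnes, smul_smul]
  let e : B := ⟨(Fintype.card X : ℂ)⁻¹ • J, S.boseMesner.smul_mem S.allOnes_mem _⟩
  have he : e ≠ 0 := fun h => by
    have h1 := congrFun (congrFun (congrArg Subtype.val h) S.point) S.point
    have h2 : (Fintype.card X : ℂ)⁻¹ * 1 = 0 := h1
    simp at h2
  have hee : e * e = e := Subtype.ext (by
    change ((Fintype.card X : ℂ)⁻¹ • J) * ((Fintype.card X : ℂ)⁻¹ • J) = _ • J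
    ext x y
    simp [J, Matrix.mul_apply, hcard])
  have hae : ∀ a : B, ∃ c : ℂ, a * e = c • e := fun a => by
    obtain ⟨c, hc⟩ := hJ a.1 a.2
    refine ⟨c, Subtype.ext ?_⟩
    change a.1 * ((Fintype.card X : ℂ)⁻¹ • J) = c • ((Fintype.card X : ℂ)⁻¹ • J)
    rw [mul_smul_comm, hc, smul_comm]
  obtain ⟨I, hI⟩ : ∃ I, φ e I ≠ 0 := by
    by_contra! h
    exact he (φ.injective (by rw [map_zero]; exact funext h))
  obtain ⟨c, hc⟩ := hae (b I)
  have hc' : ∀ K, (Pi.single I 1 : MaximalSpectrum B → ℂ) K * φ e K = c * φ e K := fun K => by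
    have := congrFun (congrArg φ hc) K
    rwa [map_mul, map_smul, hb] at this
  have hc1 : c = 1 := by
    have := hc' I
    rw [Pi.single_eq_same] at this
    exact (mul_right_cancel₀ hI this).symm
  have heI : b I = e := by
    refine φ.injective (funext fun K => ?_)
    rw [hb]
    by_cases hK : K = I
    · subst hK
      have h2 : φ e K * φ e K = φ e K := by
        rw [← Pi.mul_apply, ← map_mul, hee]
      rw [Pi.single_eq_same]
      exact (mul_right_cancel₀ hI (h2.trans (one_mul _).symm)).symm
    · have := hc' K
      rw [hc1, Pi.single_eq_of_ne hK, zero_mul, one_mul] at this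
      rw [Pi.single_eq_of_ne hK, this]
  let ε : MaximalSpectrum B ≃ ι := (b.indexEquiv S.adjBasis).trans
    (Equiv.swap (b.indexEquiv S.adjBasis I) o)
  have hε : ε.symm o = I := by
    rw [Equiv.symm_apply_eq]
    simp [ε]
  refine ⟨⟨b.reindex ε, fun i => ?_, ?_⟩⟩
  · rw [Module.Basis.reindex_apply]
    exact hprim _
  · rw [Module.Basis.reindex_apply, hε, heI]

namespace PrimitiveIdempotents

variable {S} (F : S.PrimitiveIdempotents)

/-- The first eigenmatrix: `A_i = ∑ j, P j i • E_j`. -/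
def P (j i : ι) : ℂ := F.E.repr (S.adjElt i) j

/-- The second eigenmatrix: `E_i = |X|⁻¹ • ∑ j, Q j i • A_j`. -/
def Q (j i : ι) : ℂ := Fintype.card X * S.adjBasis.repr (F.E i) j

theorem mul_eq_zero_of_ne {i j : ι} (hij : i ≠ j) : F.E i * F.E j = 0 := by
  have hc : F.E i * F.E j = F.E j * F.E i := Subtype.ext (S.mul_comm_of_mem (F.E i).2 (F.E j).2)
  have hi : F.E i * F.E i = F.E i := (F.isPrimitive i).2.1
  have hj : F.E j * F.E j = F.E j := (F.isPrimitive j).2.1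
  have hid : IsIdempotentElem (F.E i * F.E j) := by
    change F.E i * F.E j * (F.E i * F.E j) = _
    rw [mul_assoc, ← mul_assoc (F.E j), ← hc, mul_assoc, hj, ← mul_assoc, hi]
  have h1 := (F.isPrimitive i).2.2 _ hid (by rw [← mul_assoc, hi])
    (by rw [mul_assoc, ← hc, ← mul_assoc, hi])
  have h2 := (F.isPrimitive j).2.2 _ hid (by rw [hc, ← mul_assoc, hj]) (by rw [mul_assoc, hj])
  rcases h1 with h1 | h1
  · exact h1
  rcases h2 with h2 | h2
  · exact h2
  · exact absurd (F.E.injective (h1.symm.trans h2)) hij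

theorem P_base (i : ι) : F.P o i = S.valency i := by
  classical
  have h : S.adjElt i * F.E o = F.P o i • F.E o := by
    conv_lhs => rw [← F.E.sum_repr (S.adjElt i)]
    rw [Finset.sum_mul, Finset.sum_eq_single o]
    · rw [smul_mul_assoc, (F.isPrimitive o).2.1]; rfl
    · intro j _ hj
      rw [smul_mul_assoc, F.mul_eq_zero_of_ne hj, smul_zero]
    · simp
  have h' : S.adjElt i * F.E o = (S.valency i : ℂ) • F.E o := Subtype.ext (by
    change S.adj i * (F.E o).1 = (S.valency i : ℂ) • (F.E o).1
    rw [F.base, mul_smul_comm, S.adj_mul_allOnes, smul_comm])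
  exact smul_left_injective ℂ (F.E.ne_zero o) (h.symm.trans h')

/-- The multiplicities `m_i = Q_{0,i}`. -/
def mult (i : ι) : ℂ := F.Q o i

/-- The cosine matrix `c_{i,j} = P_{i,j} / k_j`. -/
def cosine (i j : ι) : ℂ := F.P i j / S.valency j

end PrimitiveIdempotents

end General

end CommAssocScheme

/-- The multi-indices `(n_0, …, n_d)` with sum `N`. -/
abbrev MultiIndex (N d : ℕ) : Type := {n : Fin (d + 1) → ℕ // ∑ i, n i = N}

namespace MultiIndex

instance (N d : ℕ) : Fintype (MultiIndex N d) :=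
  Fintype.subtype (Finset.piAntidiag Finset.univ N) (by simp)

/-- The multi-index `N e_0`. -/
def base (N d : ℕ) : MultiIndex N d := ⟨Pi.single 0 N, by simp⟩

/-- The multi-index `(N - 1) e_0 + e_i`, for `N ≥ 1`. -/
def near {N d : ℕ} (hN : 1 ≤ N) (i : Fin (d + 1)) : MultiIndex N d :=
  ⟨Pi.single 0 (N - 1) + Pi.single i 1, by simp [Finset.sum_add_distrib]; omega⟩

/-- The multi-index of a word: how often each letter occurs. -/
def content {N d : ℕ} (i : Fin N → Fin (d + 1)) : MultiIndex N d :=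
  ⟨fun k => (Finset.univ.filter fun n => i n = k).card, by
    rw [← Finset.card_eq_sum_card_fiberwise (fun _ _ => Finset.mem_univ _)]; simp⟩

theorem content_surjective {N d : ℕ} (β : MultiIndex N d) :
    ∃ i : Fin N → Fin (d + 1), content i = β := by
  have hc : Fintype.card (Σ k : Fin (d + 1), Fin (β.1 k)) = Fintype.card (Fin N) := by
    simp [β.2]
  let e := Fintype.equivOfCardEq hc
  refine ⟨fun n => (e.symm n).1, Subtype.ext (funext fun k => ?_)⟩
  change (Finset.univ.filter fun n => (e.symm n).1 = k).card = β.1 k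
  rw [← Fintype.card_subtype,
    Fintype.card_congr (e.symm.subtypeEquiv (q := fun s => s.1 = k) fun _ => Iff.rfl),
    Fintype.card_congr (Equiv.sigmaSubtype k)]
  simp

end MultiIndex

namespace MultiIndex

theorem content_apply {N d : ℕ} (i : Fin N → Fin (d + 1)) (k : Fin (d + 1)) :
    (content i).1 k = (Finset.univ.filter fun n => i n = k).card := rfl

theorem exists_perm_of_content_eq {N d : ℕ} {i j : Fin N → Fin (d + 1)}
    (h : content i = content j) : ∃ σ : Equiv.Perm (Fin N), ∀ n, j (σ n) = i n := by
  have e : ∀ k, Nonempty ({n // i n = k} ≃ {n // j n = k}) := fun k => by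
    refine ⟨Fintype.equivOfCardEq ?_⟩
    rw [Fintype.card_subtype, Fintype.card_subtype, ← content_apply, ← content_apply, h]
  exact ⟨Equiv.ofFiberEquiv fun k => (e k).some, Equiv.ofFiberEquiv_map _⟩

theorem content_comp_perm {N d : ℕ} (i : Fin N → Fin (d + 1)) (σ : Equiv.Perm (Fin N)) :
    content (i ∘ σ) = content i := by
  refine Subtype.ext (funext fun k => ?_)
  rw [content_apply, content_apply, ← Fintype.card_subtype, ← Fintype.card_subtype]
  exact Fintype.card_congr (σ.subtypeEquiv fun _ => Iff.rfl)

theorem content_eq_base {N d : ℕ} {i : Fin N → Fin (d + 1)} :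
    content i = base N d ↔ ∀ n, i n = 0 := by
  constructor
  · intro h
    have h0 := congrFun (congrArg Subtype.val h) 0
    rw [content_apply] at h0
    have : (Finset.univ.filter fun n => i n = 0) = Finset.univ :=
      Finset.eq_univ_of_card _ (by simpa [base] using h0)
    intro n
    have hn := Finset.mem_univ n
    rw [← this] at hn
    simpa using hn
  · intro h
    refine Subtype.ext (funext fun k => ?_)
    rw [content_apply]
    by_cases hk : k = 0
    · subst hk; simp [h, base]
    · simp [h, base, hk, Ne.symm hk]

end MultiIndex

namespace CommAssocScheme

section Extension

open MultiIndex

variable {X : Type*} [Fintype X] [DecidableEq X] {d : ℕ}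
  (S : CommAssocScheme X (Fin (d + 1)) 0) (N : ℕ)

/-- The tensor product `A_{i_1} ⊗ ⋯ ⊗ A_{i_N}`, a matrix indexed by `X ^ N`. -/
def tensorAdj {N : ℕ} (i : Fin N → Fin (d + 1)) : Matrix (Fin N → X) (Fin N → X) ℂ :=
  Matrix.of fun x y => ∏ n, S.adj (i n) (x n) (y n)

/-- The relation `R_β` of the extension: the union of the relations
`R_{i_1} ⊗ ⋯ ⊗ R_{i_N}` of the tensor power over all words `i` with content `β`, which form
one orbit of the symmetric group. -/
def symRel (β : MultiIndex N d) (x y : Fin N → X) : Prop :=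
  ∃ i : Fin N → Fin (d + 1), content i = β ∧ ∀ n, S.rel (i n) (x n) (y n)

theorem symRel_iff (β : MultiIndex N d) (x y : Fin N → X) :
    S.symRel N β x y ↔ content (fun n => S.cls (x n) (y n)) = β := by
  constructor
  · rintro ⟨i, hi, h⟩
    rw [← hi]
    congr 1
    exact funext fun n => (S.rel_iff _ _ _).1 (h n)
  · exact fun h => ⟨_, h, fun n => (S.rel_iff _ _ _).2 rfl⟩

theorem relMatrix_symRel_apply (β : MultiIndex N d) (x y : Fin N → X) :
    relMatrix (S.symRel N β) x y =
      if content (fun n => S.cls (x n) (y n)) = β then 1 else 0 := by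
  simp only [relMatrix, Matrix.of_apply, S.symRel_iff]

theorem tensorAdj_apply {N : ℕ} (i : Fin N → Fin (d + 1)) (x y : Fin N → X) :
    S.tensorAdj i x y = if (fun n => S.cls (x n) (y n)) = i then 1 else 0 := by
  simp only [tensorAdj, Matrix.of_apply, S.adj_apply, Finset.prod_boole, funext_iff,
    Finset.mem_univ, true_imp_iff]

theorem relMatrix_symRel (β : MultiIndex N d) :
    relMatrix (S.symRel N β) =
      ∑ i ∈ Finset.univ.filter (fun i : Fin N → Fin (d + 1) => content i = β), S.tensorAdj i := by
  ext x y
  rw [relMatrix_symRel_apply, Matrix.sum_apply]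
  simp [tensorAdj_apply, Finset.sum_ite_eq]

theorem tensorAdj_mul {N : ℕ} (i j : Fin N → Fin (d + 1)) (x y : Fin N → X) :
    (S.tensorAdj i * S.tensorAdj j) x y = ∏ n, (S.adj (i n) * S.adj (j n)) (x n) (y n) := by
  simp only [Matrix.mul_apply, tensorAdj, Matrix.of_apply]
  rw [Finset.prod_univ_sum, Fintype.piFinset_univ]
  simp only [Finset.prod_mul_distrib]

theorem exists_adj_mul_apply : ∃ p : Fin (d + 1) → Fin (d + 1) → Fin (d + 1) → ℕ,
    ∀ i j x y, (S.adj i * S.adj j) x y = p i j (S.cls x y) := by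
  choose p hp using S.mul_rel
  refine ⟨p, fun i j x y => ?_⟩
  rw [← S.sum_smul_adj_apply (fun k => (p i j k : ℂ))]
  exact congrFun (congrFun (hp i j) x) y

theorem exists_cls_swap : ∃ τ : Fin (d + 1) → Fin (d + 1), Function.Injective τ ∧
    ∀ x y, S.cls y x = τ (S.cls x y) := by
  choose τ hτ using S.transpose_rel
  have h : ∀ i x y, S.cls y x = i ↔ S.cls x y = τ i := fun i x y => by
    have := congrFun (congrFun (hτ i) x) y
    change S.adj i y x = S.adj (τ i) x y at this
    rw [S.adj_apply, S.adj_apply] at this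
    by_cases h1 : S.cls y x = i <;> by_cases h2 : S.cls x y = τ i <;> simp [h1, h2] at this ⊢
  refine ⟨τ, fun a b hab => ?_, fun x y => (h _ y x).1 rfl⟩
  obtain ⟨x, y, hxy⟩ := S.rel_nonempty a
  have h1 := (S.rel_iff _ _ _).1 hxy
  have h2 := (h a y x).1 h1
  rw [hab] at h2
  exact h1.symm.trans ((h b y x).2 h2)

/-- The extension `Sym(𝔛, N)`, that is the `N`-th symmetric tensor product of `𝔛`: the fusion
of the `N`-th tensor power of `𝔛` under the symmetric group, a scheme on `X ^ N`. -/
def sym : CommAssocScheme (Fin N → X) (MultiIndex N d) (MultiIndex.base N d) where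
  rel := S.symRel N
  rel_nonempty β := by
    obtain ⟨i, hi⟩ := content_surjective β
    choose x y hxy using fun n => S.rel_nonempty (i n)
    exact ⟨x, y, i, hi, hxy⟩
  rel_base := by
    ext x y
    rw [relMatrix_symRel_apply, Matrix.one_apply]
    have : ∀ a b, S.cls a b = 0 ↔ a = b := fun a b => by
      have := congrFun (congrFun S.adj_base a) b
      rw [S.adj_apply, Matrix.one_apply] at this
      refine ⟨fun h => ?_, fun h => h ▸ S.cls_self a⟩
      by_contra h2
      simp [h, h2] at this
    simp only [content_eq_base, this, funext_iff]
  sum_rel := by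
    ext x y
    simp [Matrix.sum_apply, relMatrix_symRel_apply]
  transpose_rel β := by
    obtain ⟨τ, hτ, hcls⟩ := S.exists_cls_swap
    obtain ⟨i, rfl⟩ := content_surjective β
    have hinj : ∀ (u : Fin N → Fin (d + 1)) k,
        (content (fun n => τ (u n))).1 (τ k) = (content u).1 k := fun u k => by
      simp [content_apply, hτ.eq_iff]
    refine ⟨content fun n => τ (i n), ?_⟩
    ext x y
    rw [Matrix.transpose_apply, relMatrix_symRel_apply, relMatrix_symRel_apply]
    simp only [hcls (y _) (x _)]
    congr 1
    refine propext ⟨fun h => ?_, fun h => ?_⟩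
    · obtain ⟨σ, hσ⟩ := exists_perm_of_content_eq h
      rw [← content_comp_perm (fun n => τ (i n)) σ]
      congr 1
      exact funext fun n => by simp [hσ]
    · refine Subtype.ext (funext fun k => ?_)
      rw [← hinj i, ← hinj (fun n => S.cls (y n) (x n)), h]
  mul_rel β γ := by
    obtain ⟨p, hp⟩ := S.exists_adj_mul_apply
    choose v hv using fun δ : MultiIndex N d => content_surjective δ
    let g : (Fin N → Fin (d + 1)) → ℕ := fun u =>
      ∑ i ∈ Finset.univ.filter (fun i : Fin N → Fin (d + 1) => content i = β),
        ∑ j ∈ Finset.univ.filter (fun j : Fin N → Fin (d + 1) => content j = γ),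
          ∏ n, p (i n) (j n) (u n)
    have hre : ∀ (σ : Equiv.Perm (Fin N)) (δ : MultiIndex N d) (f : (Fin N → Fin (d + 1)) → ℕ),
        ∑ i ∈ Finset.univ.filter (fun i : Fin N → Fin (d + 1) => content i = δ), f (i ∘ σ) =
        ∑ i ∈ Finset.univ.filter (fun i : Fin N → Fin (d + 1) => content i = δ), f i := by
      intro σ δ f
      refine Finset.sum_equiv (σ.symm.arrowCongr (Equiv.refl _)) (fun i => ?_) (fun i _ => rfl)
      have := content_comp_perm i σ
      simp only [Finset.mem_filter, Finset.mem_univ, true_and]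
      rw [← this]
      rfl
    have hg : ∀ (σ : Equiv.Perm (Fin N)) u, g (u ∘ σ) = g u := by
      intro σ u
      simp only [g]
      rw [← hre σ β]
      refine Finset.sum_congr rfl fun i _ => ?_
      rw [← hre σ γ]
      refine Finset.sum_congr rfl fun j _ => ?_
      exact Equiv.prod_comp σ fun n => p (i n) (j n) (u n)
    refine ⟨fun δ => g (v δ), ?_⟩
    ext x y
    have h1 : (relMatrix (S.symRel N β) * relMatrix (S.symRel N γ)) x y =
        g fun n => S.cls (x n) (y n) := by
      rw [relMatrix_symRel, relMatrix_symRel, Finset.sum_mul_sum, Matrix.sum_apply]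
      simp only [Matrix.sum_apply, tensorAdj_mul, hp, g]
      push_cast
      rfl
    obtain ⟨σ, hσ⟩ := exists_perm_of_content_eq
      (hv (content fun n => S.cls (x n) (y n))).symm
    rw [h1, Matrix.sum_apply]
    simp only [Matrix.smul_apply, relMatrix_symRel_apply, smul_eq_mul, mul_ite, mul_one, mul_zero,
      Finset.sum_ite_eq, Finset.mem_univ, if_true]
    rw [← hg σ (v _)]
    congr 2
    exact funext fun n => (hσ n).symm
  mul_comm_rel β γ := by
    rw [relMatrix_symRel, relMatrix_symRel, Finset.sum_mul_sum, Finset.sum_mul_sum,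
      Finset.sum_comm]
    refine Finset.sum_congr rfl fun j _ => Finset.sum_congr rfl fun i _ => ?_
    ext x y
    rw [tensorAdj_mul, tensorAdj_mul]
    refine Finset.prod_congr rfl fun n _ => ?_
    have : S.adj (i n) * S.adj (j n) = S.adj (j n) * S.adj (i n) := S.mul_comm_rel _ _
    rw [this]

/-- The Hamiltonian `M = ∑_{i=1}^d w_i A_{(N-1)e_0+e_i}` on `Sym(𝔛, N)`; the weight `w_i` is
`w (i - 1)`, as `i.succ` runs through `1, …, d`. -/
def hamiltonian {N : ℕ} (hN : 1 ≤ N) (w : Fin d → ℂ) : Matrix (Fin N → X) (Fin N → X) ℂ :=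
  ∑ i : Fin d, w i • (S.sym N).adj (MultiIndex.near hN i.succ)

/-- The continuous-time quantum walk `U(t) = exp(-i t M)`. -/
def evolution {Y : Type*} [Fintype Y] [DecidableEq Y] (M : Matrix Y Y ℂ) (t : ℝ) :
    Matrix Y Y ℂ :=
  NormedSpace.exp ((-(Complex.I * t)) • M)

/-- The basis vector `|x⟩`. -/
def ket {Y : Type*} [DecidableEq Y] (x : Y) : Y → ℂ := Pi.single x 1

/-- The site `|Y_β⟩ = k_β^{-1/2} A_β |x₀⟩`. -/
def site {N : ℕ} (x₀ : Fin N → X) (β : MultiIndex N d) : (Fin N → X) → ℂ :=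
  ((1 / √((S.sym N).valency β : ℝ) : ℝ) : ℂ) • ((S.sym N).adj β *ᵥ ket x₀)

variable {S}

/-- The `k`-th factor
`1 + ∑_{ℓ=1}^d conj c_{ℓ,k} m_ℓ exp(i t ∑_{i=1}^d w_i k_i (1 - c_{ℓ,i}))`. -/
def walkFactor (F : S.PrimitiveIdempotents) (w : Fin d → ℂ) (t : ℝ) (k : Fin (d + 1)) : ℂ :=
  1 + ∑ l : Fin d, star (F.cosine l.succ k) * F.mult l.succ *
    Complex.exp (Complex.I * t *
      ∑ i : Fin d, w i * S.valency i.succ * (1 - F.cosine l.succ i.succ))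

/-- The coefficient
`f_β(t) = |X|^{-N} exp(-i t N ∑_{i=1}^d w_i k_i) ∏_{k=0}^d (k-th factor)^{β_k}`. -/
def walkCoeff (F : S.PrimitiveIdempotents) {N : ℕ} (w : Fin d → ℂ) (t : ℝ)
    (β : MultiIndex N d) : ℂ :=
  1 / (Fintype.card X : ℂ) ^ N *
    Complex.exp (-(Complex.I * t * N * ∑ i : Fin d, w i * S.valency i.succ)) *
    ∏ k, walkFactor F w t k ^ β.1 k

end Extension

end CommAssocScheme

end

/-! The matrix `A_{(N-1)e_0+e_i}` is the sum over the `N` sites of `A_i` placed at one site with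
identities at the others. So `M` is a sum of `N` commuting one-site copies of `H = ∑ w_i A_i`, and
`exp(-itM)` is the `N`-th tensor power of `exp(-itH)`. In terms of eigenvalues: the products
`E_{j_1} ⊗ ⋯ ⊗ E_{j_N}` are complete orthogonal idempotents, on which `M` acts by `θ_{j_1} + ⋯ +
θ_{j_N}` with `θ_j = ∑ w_i P_{j,i}` (`hamiltonian_eq_sum`), and exponentiating turns this sum into a
product over sites.

At one site, `E_j` has the entry `|X|⁻¹ Q_{k,j}` on `R_k`, and `Q_{k,j} = conj c_{j,k} · m_j`
(`Q_eq_star_cosine_mul_mult`). Extracting the phase of `θ_0 = ∑ w_i k_i` leaves exactly `p_k(t)`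
(`sum_exp_smul_E_apply`). The product of these entries over the sites depends only on how often each
class `k` occurs, which gives `f_β`. Since `|Y_β⟩` is supported where the amplitude is `f_β(t)`, a
vanishing factor `p_k(t)` with `β_k ≠ 0` kills the inner product. -/

/-! ### Exponential of a spectral decomposition -/

/-- The exponential of a linear combination of complete orthogonal idempotent matrices. -/
theorem CompleteOrthogonalIdempotents.matrix_exp_sum_smul {J Y : Type*} [Fintype J] [Fintype Y]
    [DecidableEq Y] {e : J → Matrix Y Y ℂ} (he : CompleteOrthogonalIdempotents e) (c : J → ℂ) :
    NormedSpace.exp (∑ j, c j • e j) = ∑ j, Complex.exp (c j) • e j := by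
  classical
  let _ : NormedRing (Matrix Y Y ℂ) := Matrix.linftyOpNormedRing
  let _ : NormedAlgebra ℂ (Matrix Y Y ℂ) := Matrix.linftyOpNormedAlgebra
  -- Complete orthogonal idempotents amount to an algebra homomorphism from `ℂ^J`. It is continuous
  -- by finite dimension, so it commutes with `exp`, which is coordinatewise on `ℂ^J`.
  let φ : (J → ℂ) →ₐ[ℂ] Matrix Y Y ℂ := AlgHom.ofLinearMap (Fintype.linearCombination ℂ e)
    (by simp [Fintype.linearCombination_apply, he.complete])
    (fun a b => by
      simp only [Fintype.linearCombination_apply, Finset.sum_mul_sum, smul_mul_smul_comm, he.mul_eq,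
        smul_ite, smul_zero, Finset.sum_ite_eq, Finset.mem_univ, if_true, Pi.mul_apply])
  have hφ : ∀ a, φ a = ∑ j, a j • e j := fun a => Fintype.linearCombination_apply ℂ e a
  have hcont : Continuous φ := φ.toLinearMap.continuous_of_finiteDimensional
  rw [← hφ]
  refine (NormedSpace.map_exp φ hcont c).symm.trans ((hφ _).trans ?_)
  refine Finset.sum_congr rfl fun j _ => ?_
  rw [Pi.coe_exp, Complex.exp_eq_exp_ℂ]

/-! ### Words and their contents -/

namespace MultiIndex

theorem content_single {N d : ℕ} (hN : 1 ≤ N) (n : Fin N) {i : Fin (d + 1)} (hi : i ≠ 0) :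
    content (Pi.single n i : Fin N → Fin (d + 1)) = near hN i := by
  refine Subtype.ext (funext fun k => ?_)
  rw [content_apply]
  change _ = (Pi.single 0 (N - 1) + Pi.single i 1 : Fin (d + 1) → ℕ) k
  have h : ∀ m, (Pi.single n i : Fin N → Fin (d + 1)) m = k ↔ if m = n then i = k else 0 = k :=
    fun m => by by_cases hm : m = n <;> simp [hm]
  simp only [h]
  by_cases hk : k = 0
  · subst hk
    have : (Finset.univ.filter fun m : Fin N => if m = n then i = 0 else (0 : Fin (d + 1)) = 0) =
        Finset.univ.erase n := by
      ext m; by_cases hm : m = n <;> simp [hm, hi]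
    rw [this, Finset.card_erase_of_mem (Finset.mem_univ _)]
    simp [Ne.symm hi]
  · by_cases hik : k = i
    · subst hik
      have : (Finset.univ.filter fun m : Fin N => if m = n then k = k else 0 = k) = {n} := by
        ext m; by_cases hm : m = n <;> simp [hm, Ne.symm hi]
      rw [this]
      simp [hi]
    · have : (Finset.univ.filter fun m : Fin N => if m = n then i = k else 0 = k) = ∅ := by
        ext m; by_cases hm : m = n <;> simp [hm, Ne.symm hk, Ne.symm hik]
      rw [this]
      simp [hk, hik]

theorem content_eq_near {N d : ℕ} (hN : 1 ≤ N) {i : Fin (d + 1)} (hi : i ≠ 0)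
    (u : Fin N → Fin (d + 1)) : content u = near hN i ↔ ∃ n, Pi.single n i = u := by
  constructor
  · intro h
    -- Words of equal content differ by a permutation of the positions, so `u` is compared with the
    -- word that has `i` at position `0`.
    obtain ⟨σ, hσ⟩ := exists_perm_of_content_eq (h.trans (content_single hN ⟨0, hN⟩ hi).symm)
    refine ⟨σ.symm ⟨0, hN⟩, funext fun n => ?_⟩
    rw [← hσ n, Pi.single_apply, Pi.single_apply]
    simp only [Equiv.eq_symm_apply]
  · rintro ⟨n, rfl⟩
    exact content_single hN n hi

theorem prod_comp_eq_prod_pow_content {N d : ℕ} {R : Type*} [CommMonoid R]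
    (g : Fin (d + 1) → R) (u : Fin N → Fin (d + 1)) :
    ∏ n, g (u n) = ∏ k, g k ^ (content u).1 k := by
  rw [← Finset.prod_fiberwise Finset.univ u]
  refine Finset.prod_congr rfl fun k _ => ?_
  rw [content_apply, ← Finset.prod_const]
  exact Finset.prod_congr rfl fun n hn => by rw [(Finset.mem_filter.1 hn).2]

end MultiIndex

/-! ### Eigenmatrices of a single scheme -/

namespace CommAssocScheme

section General

variable {X ι : Type*} [Fintype X] [DecidableEq X] [Fintype ι] {o : ι}
  (S : CommAssocScheme X ι o)

theorem card_ne_zero (S : CommAssocScheme X ι o) : (Fintype.card X : ℂ) ≠ 0 := by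
  have : Nonempty X := ⟨S.point⟩
  exact Nat.cast_ne_zero.2 Fintype.card_ne_zero

theorem valency_ne_zero (i : ι) : (S.valency i : ℂ) ≠ 0 := by
  obtain ⟨x, y, h⟩ := S.rel_nonempty i
  rw [← S.card_rel_eq_valency i x]
  have : Nonempty {y // S.rel i x y} := ⟨⟨y, h⟩⟩
  exact Nat.cast_ne_zero.2 Nat.card_pos.ne'

theorem sum_adj_apply (i : ι) (x : X) : ∑ y, S.adj i x y = S.valency i := by
  classical
  rw [← S.card_rel_eq_valency i x, Nat.card_eq_fintype_card, Fintype.card_subtype]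
  simp [adj, relMatrix, Finset.sum_boole]

theorem star_adj_apply (i : ι) (x y : X) : star (S.adj i x y) = S.adj i x y := by
  classical
  rw [S.adj_apply]
  split_ifs <;> simp

/-- The adjacency matrices are orthogonal for the trace form. -/
theorem trace_conjTranspose_adj_mul (i : ι) (c : ι → ℂ) :
    ((S.adj i)ᴴ * ∑ j, c j • S.adj j).trace = Fintype.card X * (S.valency i * c i) := by
  classical
  -- The relations partition the pairs: on `R_i` the combination has the constant value `c i`, and
  -- off `R_i` the first factor is zero.
  have h : ∀ x y, star (S.adj i x y) * (∑ j, c j • S.adj j) x y = S.adj i x y * c i := by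
    intro x y
    rw [S.star_adj_apply, S.sum_smul_adj_apply, S.adj_apply]
    split_ifs with hxy
    · rw [hxy]
    · simp
  simp only [Matrix.trace, Matrix.diag_apply, Matrix.mul_apply, Matrix.conjTranspose_apply]
  rw [Finset.sum_comm]
  simp only [h, ← Finset.sum_mul, S.sum_adj_apply]
  simp [mul_assoc]

namespace PrimitiveIdempotents

variable {S} (F : S.PrimitiveIdempotents)

theorem E_mul_E [DecidableEq ι] (i j : ι) :
    (F.E i : Matrix X X ℂ) * F.E j = if i = j then (F.E i : Matrix X X ℂ) else 0 := by
  split_ifs with h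
  · subst h
    exact congrArg Subtype.val (F.isPrimitive i).2.1
  · exact congrArg Subtype.val (F.mul_eq_zero_of_ne h)

/-- Orthogonality kills every term of the expansion of `a` except the `j`-th, so coordinates in the
idempotent basis are eigenvalues. -/
theorem repr_mul_E (a : S.boseMesner) (j : ι) :
    (a : Matrix X X ℂ) * F.E j = F.E.repr a j • (F.E j : Matrix X X ℂ) := by
  classical
  have h := congrArg Subtype.val (F.E.sum_repr a)
  rw [AddSubmonoidClass.coe_finsetSum] at h
  conv_lhs => rw [← h]
  simp [Finset.sum_mul, F.E_mul_E]

theorem adj_eq_sum (i : ι) : S.adj i = ∑ j, F.P j i • (F.E j : Matrix X X ℂ) := by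
  have h := congrArg Subtype.val (F.E.sum_repr (S.adjElt i))
  rw [AddSubmonoidClass.coe_finsetSum] at h
  exact h.symm

theorem E_eq_sum (j : ι) :
    (F.E j : Matrix X X ℂ) = ∑ i, ((Fintype.card X : ℂ)⁻¹ * F.Q i j) • S.adj i := by
  have h := congrArg Subtype.val (S.adjBasis.sum_repr (F.E j))
  rw [AddSubmonoidClass.coe_finsetSum] at h
  rw [← h]
  refine Finset.sum_congr rfl fun i _ => ?_
  rw [Q, inv_mul_cancel_left₀ S.card_ne_zero]
  simp [adjBasis, adjElt]

theorem E_apply (j : ι) (x y : X) :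
    (F.E j : Matrix X X ℂ) x y = (Fintype.card X : ℂ)⁻¹ * F.Q (S.cls x y) j := by
  rw [F.E_eq_sum, S.sum_smul_adj_apply]

/-- `A_o` is the identity, so all its eigenvalues are `1`. This makes the idle sites of a tensor
product contribute trivially. -/
theorem P_right_base (j : ι) : F.P j o = 1 := by
  have h1 := F.repr_mul_E (S.adjElt o) j
  refine smul_left_injective ℂ (F.E.ne_zero j) (Subtype.ext ?_)
  change F.P j o • (F.E j : Matrix X X ℂ) = (1 : ℂ) • (F.E j : Matrix X X ℂ)
  refine h1.symm.trans ?_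
  change S.adj o * (F.E j : Matrix X X ℂ) = _
  rw [S.adj_base, one_mul, one_smul]

open scoped ComplexOrder in
/-- The primitive idempotents are Hermitian. -/
theorem conjTranspose_E (j : ι) : (F.E j : Matrix X X ℂ)ᴴ = F.E j := by
  set e := (F.E j : Matrix X X ℂ)
  have hne : e ≠ 0 := fun h => F.E.ne_zero j (Subtype.ext h)
  have hee : e * e = e := congrArg Subtype.val (F.isPrimitive j).2.1
  -- The algebra is closed under the adjoint, so `eᴴ` acts on `e` by a scalar.
  obtain ⟨c, hc⟩ : ∃ c : ℂ, eᴴ * e = c • e :=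
    ⟨_, F.repr_mul_E ⟨eᴴ, S.conjTranspose_mem (F.E j).2⟩ j⟩
  have hc0 : c ≠ 0 := by
    rintro rfl
    rw [zero_smul] at hc
    exact hne (Matrix.conjTranspose_mul_self_eq_zero.1 hc)
  -- `eᴴ * e` is Hermitian.
  have h1 : c • e = star c • eᴴ := by
    have := congrArg Matrix.conjTranspose hc
    rwa [Matrix.conjTranspose_mul, Matrix.conjTranspose_conjTranspose, hc,
      Matrix.conjTranspose_smul] at this
  have h2 : c • e = c • eᴴ := by
    rw [← hc]
    have h3 : eᴴ * eᴴ = eᴴ := by rw [← Matrix.conjTranspose_mul, hee]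
    have h4 : eᴴ * (c • e) = star c • eᴴ := by rw [h1, mul_smul_comm, h3]
    rw [mul_smul_comm, hc, ← h1] at h4
    -- Evaluating `eᴴ * (c • e)` in two ways has given `c² • e = c • e`, and `c ≠ 0`.
    have hc1 : c = 1 := by
      rw [smul_smul] at h4
      exact mul_right_cancel₀ hc0 ((smul_left_injective ℂ hne h4).trans (one_mul c).symm)
    rw [hc, h1, hc1, star_one]
  exact (smul_right_injective _ hc0 h2).symm

/-- Since each `E_j` is Hermitian, taking adjoints of the spectral expansion only conjugates the
eigenvalues. This is the source of the conjugate in `p_k`. -/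
theorem conjTranspose_adj_mul_E (i j : ι) :
    (S.adj i)ᴴ * (F.E j : Matrix X X ℂ) = star (F.P j i) • (F.E j : Matrix X X ℂ) := by
  classical
  rw [F.adj_eq_sum, Matrix.conjTranspose_sum, Finset.sum_mul]
  simp [F.conjTranspose_E, F.E_mul_E]

/-- Diagonal pairs all lie in `R_o`, so the diagonal of `E_j` is constant, equal to `m_j / |X|`. -/
theorem trace_E (j : ι) : (F.E j : Matrix X X ℂ).trace = F.mult j := by
  simp only [Matrix.trace, Matrix.diag_apply, F.E_apply, S.cls_self]
  simp [mult, S.card_ne_zero]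

/-- The relation `Q_{i,j} / m_j = conj P_{j,i} / k_i` between the two eigenmatrices. -/
theorem Q_eq_star_cosine_mul_mult (i j : ι) : F.Q i j = star (F.cosine j i) * F.mult j := by
  -- The trace of `A_iᴴ E_j` is computed twice: the expansion of `E_j` in adjacency matrices gives
  -- `k_i Q_{i,j}`, the eigenvalue gives `conj P_{j,i} · m_j`.
  have h := S.trace_conjTranspose_adj_mul i fun i => (Fintype.card X : ℂ)⁻¹ * F.Q i j
  rw [← F.E_eq_sum, F.conjTranspose_adj_mul_E, Matrix.trace_smul, F.trace_E, smul_eq_mul,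
    mul_left_comm (S.valency i : ℂ), mul_inv_cancel_left₀ S.card_ne_zero] at h
  rw [cosine, star_div₀, star_natCast, div_mul_eq_mul_div, h,
    mul_div_cancel_left₀ _ (S.valency_ne_zero i)]

theorem P_eq (i j : ι) : F.P i j = S.valency j * F.cosine i j := by
  rw [cosine, mul_div_cancel₀ _ (S.valency_ne_zero j)]

/-- Together with `mult_base`, this turns the term `ℓ = 0` of the spectral sum into the leading `1`
of `p_k`. -/
theorem cosine_base (i : ι) : F.cosine o i = 1 := by
  rw [cosine, P_base, div_self (S.valency_ne_zero i)]

theorem mult_base : F.mult o = 1 := by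
  have h := F.E_apply o S.point S.point
  rw [F.base, S.cls_self] at h
  simpa [mult, S.card_ne_zero] using h.symm

end PrimitiveIdempotents

end General

/-! ### Tensor idempotents and the evolution on the symmetric tensor product -/

section Extension

open MultiIndex

variable {X : Type*} [Fintype X] [DecidableEq X] {d : ℕ}
  {S : CommAssocScheme X (Fin (d + 1)) 0}

/-- The tensor product `E_{j_1} ⊗ ⋯ ⊗ E_{j_N}`. -/
noncomputable def tensorIdem (F : S.PrimitiveIdempotents) {N : ℕ} (j : Fin N → Fin (d + 1)) :
    Matrix (Fin N → X) (Fin N → X) ℂ :=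
  Matrix.of fun x y => ∏ n, (F.E (j n) : Matrix X X ℂ) (x n) (y n)

/-- Distributivity: coefficients that factor over the sites give a tensor product of one-site
matrices. It serves both to diagonalise the adjacency tensors and to factor the exponential. -/
theorem sum_prod_smul_tensorIdem_apply (F : S.PrimitiveIdempotents) {N : ℕ}
    (c : Fin N → Fin (d + 1) → ℂ) (x y : Fin N → X) :
    (∑ j : Fin N → Fin (d + 1), (∏ n, c n (j n)) • tensorIdem F j) x y =
      ∏ n, (∑ k, c n k • (F.E k : Matrix X X ℂ)) (x n) (y n) := by
  simp only [Matrix.sum_apply, Matrix.smul_apply, tensorIdem, Matrix.of_apply, smul_eq_mul,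
    ← Finset.prod_mul_distrib]
  rw [Finset.prod_univ_sum, Fintype.piFinset_univ]

theorem tensorAdj_eq_sum (F : S.PrimitiveIdempotents) {N : ℕ} (i : Fin N → Fin (d + 1)) :
    S.tensorAdj i = ∑ j : Fin N → Fin (d + 1), (∏ n, F.P (j n) (i n)) • tensorIdem F j := by
  ext x y
  rw [sum_prod_smul_tensorIdem_apply F fun n k => F.P k (i n)]
  simp only [← F.adj_eq_sum, tensorAdj, Matrix.of_apply]

theorem completeOrthogonalIdempotents_tensorIdem (F : S.PrimitiveIdempotents) (N : ℕ) :
    CompleteOrthogonalIdempotents (tensorIdem F : (Fin N → Fin (d + 1)) → _) := by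
  have hmul : ∀ i j : Fin N → Fin (d + 1),
      tensorIdem F i * tensorIdem F j = if i = j then tensorIdem F i else 0 := by
    intro i j
    ext x y
    have h1 : (tensorIdem F i * tensorIdem F j) x y =
        ∏ n, ((F.E (i n) : Matrix X X ℂ) * F.E (j n)) (x n) (y n) := by
      simp only [Matrix.mul_apply, tensorIdem, Matrix.of_apply]
      rw [Finset.prod_univ_sum, Fintype.piFinset_univ]
      simp only [Finset.prod_mul_distrib]
    rw [h1]
    split_ifs with h
    · subst h
      simp only [F.E_mul_E, if_true, tensorIdem, Matrix.of_apply]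
    · obtain ⟨n, hn⟩ := Function.ne_iff.1 h
      -- One site at which the words differ already annihilates the whole product.
      rw [Matrix.zero_apply]
      exact Finset.prod_eq_zero (Finset.mem_univ n) (by simp [F.E_mul_E, hn])
  refine ⟨⟨fun i => ?_, fun i j hij => ?_⟩, ?_⟩
  · exact (hmul i i).trans (if_pos rfl)
  · exact (hmul i j).trans (if_neg hij)
  -- Completeness is the spectral expansion of the all-zero word, whose tensor is the identity and
  -- whose eigenvalues are all `1`.
  · have h := tensorAdj_eq_sum F (0 : Fin N → Fin (d + 1))
    simp only [Pi.zero_apply, F.P_right_base, Finset.prod_const_one, one_smul] at h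
    rw [← h]
    ext x y
    simp only [tensorAdj, Matrix.of_apply, Pi.zero_apply, S.adj_base, Matrix.one_apply,
      Finset.prod_boole, funext_iff, Finset.mem_univ, true_imp_iff]

/-- The words of content `(N-1)e_0+e_i` have a single nonzero letter. As `i ≠ 0`, the position of
that letter is determined by the word, so each word is counted once. -/
theorem sym_adj_near {N : ℕ} (hN : 1 ≤ N) {i : Fin (d + 1)} (hi : i ≠ 0) :
    (S.sym N).adj (near hN i) = ∑ n : Fin N, S.tensorAdj (Pi.single n i) := by
  refine (S.relMatrix_symRel N (near hN i)).trans ?_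
  have hinj : Function.Injective fun n : Fin N => (Pi.single n i : Fin N → Fin (d + 1)) := by
    intro m n h
    by_contra hmn
    have := congrFun h m
    simp [hmn, hi] at this
  rw [← Finset.sum_image (s := Finset.univ) (f := fun u => S.tensorAdj u) hinj.injOn]
  refine Finset.sum_congr ?_ fun _ _ => rfl
  ext u
  simp [content_eq_near hN hi]

/-- The eigenvalue of `∑_{i=1}^d w_i A_i` on the range of `E_j`. -/
noncomputable def localEigenvalue (F : S.PrimitiveIdempotents) (w : Fin d → ℂ) (j : Fin (d + 1)) : ℂ :=
  ∑ i : Fin d, w i * F.P j i.succ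

/-- Each summand acts at a single site, so the eigenvalue on a tensor idempotent is the sum of the
one-site eigenvalues. -/
theorem hamiltonian_eq_sum (F : S.PrimitiveIdempotents) {N : ℕ} (hN : 1 ≤ N) (w : Fin d → ℂ) :
    S.hamiltonian hN w = ∑ j : Fin N → Fin (d + 1),
      (∑ n, localEigenvalue F w (j n)) • tensorIdem F j := by
  have hP : ∀ (j : Fin N → Fin (d + 1)) (n : Fin N) (i : Fin (d + 1)),
      ∏ m, F.P (j m) ((Pi.single n i : Fin N → Fin (d + 1)) m) = F.P (j n) i := by
    intro j n i
    rw [Finset.prod_eq_single n]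
    · simp
    · intro m _ hm
      rw [Pi.single_eq_of_ne hm, F.P_right_base]
    · simp
  have h : ∀ i : Fin d, w i • (S.sym N).adj (near hN i.succ) =
      ∑ j : Fin N → Fin (d + 1), (∑ n, w i * F.P (j n) i.succ) • tensorIdem F j := by
    intro i
    rw [sym_adj_near hN (Fin.succ_ne_zero i)]
    simp only [tensorAdj_eq_sum F, hP]
    rw [Finset.sum_comm, Finset.smul_sum]
    refine Finset.sum_congr rfl fun j _ => ?_
    rw [← Finset.sum_smul, smul_smul, Finset.mul_sum]
  simp only [hamiltonian, h, localEigenvalue]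
  rw [Finset.sum_comm]
  refine Finset.sum_congr rfl fun j _ => ?_
  rw [← Finset.sum_smul, Finset.sum_comm]

/-- The left side is the one-site evolution in spectral form; this is where the factor `p_k` arises.
-/
theorem sum_exp_smul_E_apply (F : S.PrimitiveIdempotents) (w : Fin d → ℂ) (t : ℝ) (x y : X) :
    (∑ j, Complex.exp (-(Complex.I * t) * localEigenvalue F w j) • (F.E j : Matrix X X ℂ)) x y =
      (Fintype.card X : ℂ)⁻¹ *
        Complex.exp (-(Complex.I * t * ∑ i : Fin d, w i * S.valency i.succ)) *
        walkFactor F w t (S.cls x y) := by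
  have hexp : ∀ j, Complex.exp (-(Complex.I * t) * localEigenvalue F w j) =
      Complex.exp (-(Complex.I * t * ∑ i : Fin d, w i * S.valency i.succ)) *
      Complex.exp (Complex.I * t *
        ∑ i : Fin d, w i * S.valency i.succ * (1 - F.cosine j i.succ)) := by
    -- `θ_j = ∑ w_i k_i c_{j,i}` is written as `θ_0 - ∑ w_i k_i (1 - c_{j,i})`, so that the phase of
    -- `θ_0` is common to all `j`.
    intro j
    rw [← Complex.exp_add]
    simp only [localEigenvalue, F.P_eq, mul_sub, mul_one, Finset.sum_sub_distrib, mul_assoc]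
    congr 1
    ring
  simp only [Matrix.sum_apply, Matrix.smul_apply, smul_eq_mul, F.E_apply,
    F.Q_eq_star_cosine_mul_mult, hexp]
  rw [Fin.sum_univ_succ, walkFactor, mul_add]
  congr 1
  · simp [F.cosine_base, F.mult_base, mul_comm]
  · refine Eq.trans (Finset.sum_congr rfl fun l _ => ?_) (Finset.mul_sum _ _ _).symm
    ring

/-- The entries of the evolution operator. -/
theorem evolution_hamiltonian_apply (F : S.PrimitiveIdempotents) {N : ℕ} (hN : 1 ≤ N)
    (w : Fin d → ℂ) (t : ℝ) (x y : Fin N → X) :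
    evolution (S.hamiltonian hN w) t x y = walkCoeff F w t ((S.sym N).cls x y) := by
  have hcls : (S.sym N).cls x y = content fun n => S.cls (x n) (y n) :=
    ((S.symRel_iff N _ x y).1 (((S.sym N).rel_iff _ x y).2 rfl)).symm
  rw [evolution, hamiltonian_eq_sum F, Finset.smul_sum]
  simp only [smul_smul]
  rw [(completeOrthogonalIdempotents_tensorIdem F N).matrix_exp_sum_smul]
  -- The exponent is a sum over the sites, so its exponential is a product and the sum over words
  -- factors.
  simp only [Finset.mul_sum, Complex.exp_sum]
  rw [sum_prod_smul_tensorIdem_apply F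
    fun _ k => Complex.exp (-(Complex.I * t) * localEigenvalue F w k)]
  simp only [sum_exp_smul_E_apply]
  rw [Finset.prod_mul_distrib, Finset.prod_const, Finset.card_univ, Fintype.card_fin,
    prod_comp_eq_prod_pow_content (walkFactor F w t), walkCoeff, hcls, mul_pow, ← Complex.exp_nat_mul]
  congr 2
  · rw [inv_pow, one_div]
  · congr 1
    ring

end Extension

end CommAssocScheme

/-- In the walk that starts at `x₀`, the amplitude `⟨Y_β| exp(-itM) |x₀⟩` is zero whenever
`β_k ≠ 0` and the `k`-th factor vanishes at `t`. -/
theorem mainTheorem2 {X : Type*} [Fintype X] [DecidableEq X] {d : ℕ}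
    (S : CommAssocScheme X (Fin (d + 1)) 0) (F : S.PrimitiveIdempotents)
    {N : ℕ} (hN : 1 ≤ N) (w : Fin d → ℂ) (hM : (S.hamiltonian hN w).IsHermitian) :
    (∀ t : ℝ, CommAssocScheme.evolution (S.hamiltonian hN w) t =
      ∑ β : MultiIndex N d, CommAssocScheme.walkCoeff F w t β • (S.sym N).adj β) ∧
    ∀ (x₀ : Fin N → X) (t : ℝ) (β : MultiIndex N d) (k : Fin (d + 1)), β.1 k ≠ 0 →
      CommAssocScheme.walkFactor F w t k = 0 →
      star (S.site x₀ β) ⬝ᵥ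
        (CommAssocScheme.evolution (S.hamiltonian hN w) t *ᵥ CommAssocScheme.ket x₀) = 0 := by
  classical
  refine ⟨fun t => ?_, fun x₀ t β k hβ hk => ?_⟩
  · ext x y
    rw [CommAssocScheme.evolution_hamiltonian_apply F, CommAssocScheme.sum_smul_adj_apply]
  · rw [CommAssocScheme.site, CommAssocScheme.ket, Matrix.mulVec_single_one,
      Matrix.mulVec_single_one, dotProduct]
    -- Every term vanishes: either `(x, x₀)` is outside `R_β` and the site vector is zero at `x`, or
    -- the amplitude at `x` is `f_β(t)`.
    refine Finset.sum_eq_zero fun x _ => ?_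
    simp only [Pi.star_apply, Pi.smul_apply, Matrix.col_apply, smul_eq_mul, star_mul',
      CommAssocScheme.star_adj_apply, CommAssocScheme.evolution_hamiltonian_apply F]
    rw [CommAssocScheme.adj_apply]
    split_ifs with h
    · rw [h, CommAssocScheme.walkCoeff, Finset.prod_eq_zero (Finset.mem_univ k), mul_zero, mul_zero]
      -- `β_k ≠ 0` is essential here, because `0 ^ 0 = 1`.
      rw [hk, zero_pow hβ]
    · simp
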